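/- For a permutation $\sigma$ of $[n]=\{1,\dots,n\}$ write $|\sigma|=n$, and let $fp(\sigma)$ be its number of fixed points. The permutation $\sigma$ contains a pattern $\tau\in S_3$ if there are indices $i_1<i_2<i_3$ such that $(\sigma_{i_1},\sigma_{i_2},\sigma_{i_3})$ has the same relative order as $\tau$; otherwise $\sigma$ avoids $\tau$. For $n\ge 0$ let $\mathbf{Iv}_n(\tau)$ be the set of permutations $\sigma$ of $[n]$ with $\sigma^{-1}=\sigma$ that avoid $\tau$, and let $\mathbf{Iv}(\tau)=\bigcup_{n\ge 0}\mathbf{Iv}_n(\tau)$. Proposition. Let $\tau\in\{321,132,213\}$. Then, as formal power series in $t$ with coefficients in $\mathbb{Q}[x]$, $$F_{\mathbf{Iv}(\tau)}(x,t):=\sum_{\sigma\in\mathbf{Iv}(\tau)}x^{fp(\sigma)}t^{|\sigma|}=\frac{2}{1-2xt+\sqrt{1-4t^2}},$$ where $\sqrt{1-4t^2}$ denotes the power series with constant term $1$ whose square is $1-4t^2$. -/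

import Mathlib

open scoped Polynomial

/-- The permutation `σ` of an `n`-element ordered set contains the pattern `τ` if for some positions
`i 0 < ⋯ < i (k-1)` the values of `σ` there are in the same relative order as those of `τ`. -/
def ContainsPattern {n k : ℕ} (σ : Equiv.Perm (Fin n)) (τ : Equiv.Perm (Fin k)) : Prop :=
  ∃ i : Fin k → Fin n, StrictMono i ∧ ∀ a b : Fin k, σ (i a) < σ (i b) ↔ τ a < τ b

/-- The permutation `σ` avoids the pattern `τ`. -/
def AvoidsPattern {n k : ℕ} (σ : Equiv.Perm (Fin n)) (τ : Equiv.Perm (Fin k)) : Prop :=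
  ¬ ContainsPattern σ τ

open Classical in
/-- The set of `τ`-avoiding involutions of an `n`-element ordered set; the identity counts as an
involution. -/
noncomputable def avoidingInvolutions {k : ℕ} (τ : Equiv.Perm (Fin k)) (n : ℕ) :
    Finset (Equiv.Perm (Fin n)) :=
  Finset.univ.filter fun σ => σ⁻¹ = σ ∧ AvoidsPattern σ τ

/-- The number of fixed points of a permutation. -/
def numFixedPoints {n : ℕ} (σ : Equiv.Perm (Fin n)) : ℕ :=
  (Finset.univ.filter fun i => σ i = i).card

/-- The generating function `∑ x ^ fp(σ) * t ^ |σ|` over all `τ`-avoiding involutions `σ`, as a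
formal power series in `t` (the variable `PowerSeries.X`) whose coefficients are polynomials in `x`
(the variable `Polynomial.X`). -/
noncomputable def involutionBGF {k : ℕ} (τ : Equiv.Perm (Fin k)) : PowerSeries ℚ[X] :=
  PowerSeries.mk fun n =>
    ∑ σ ∈ avoidingInvolutions τ n, (Polynomial.X : ℚ[X]) ^ numFixedPoints σ

/-- The square root of a formal power series `f` with constant term `1`, given by the binomial
series `(1 + u) ^ (1/2)` at `u = f - 1`. -/
noncomputable def formalSqrt (f : PowerSeries ℚ[X]) : PowerSeries ℚ[X] :=
  (PowerSeries.binomialSeries ℚ[X] (1 / 2 : ℚ)).subst (f - 1)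

theorem formalSqrt_sq (f : PowerSeries ℚ[X]) (hf : PowerSeries.constantCoeff f = 1) :
    formalSqrt f ^ 2 = f := by
  have h : PowerSeries.HasSubst (f - 1) :=
    PowerSeries.HasSubst.of_constantCoeff_zero' (by simp [hf])
  have e : PowerSeries.binomialSeries ℚ[X] (1 / 2 : ℚ) ^ 2 = 1 + PowerSeries.X := by
    rw [sq, ← PowerSeries.binomialSeries_add]
    have := PowerSeries.binomialSeries_nat (R := ℚ) (A := ℚ[X]) 1
    norm_num at this ⊢
    exact this
  rw [formalSqrt, ← PowerSeries.subst_pow h, e, PowerSeries.subst_add h, PowerSeries.subst_X h,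
    ← PowerSeries.coe_substAlgHom h, map_one]
  ring

theorem constantCoeff_formalSqrt (f : PowerSeries ℚ[X]) (hf : PowerSeries.constantCoeff f = 1) :
    PowerSeries.constantCoeff (formalSqrt f) = 1 := by
  have h : PowerSeries.constantCoeff (f - 1) = 0 := by simp [hf]
  have e : PowerSeries.binomialSeries ℚ[X] (1 / 2 : ℚ) =
      (PowerSeries.binomialSeries ℚ[X] (1 / 2 : ℚ) - 1) + 1 := by ring
  have hs := PowerSeries.HasSubst.of_constantCoeff_zero' h
  have hz := PowerSeries.constantCoeff_subst_eq_zero (R := ℚ[X]) (a := f - 1) h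
    (PowerSeries.binomialSeries ℚ[X] (1 / 2 : ℚ) - 1) (by simp)
  rw [formalSqrt, e, PowerSeries.subst_add hs, map_add]
  have h1 : (1 : PowerSeries ℚ[X]).subst (f - 1) = 1 := by
    rw [← PowerSeries.coe_substAlgHom hs, map_one]
  rw [h1, map_one]
  change PowerSeries.constantCoeff _ = 0 at hz
  rw [hz, zero_add]

/-- The denominator `1 - 2 * x * t + √(1 - 4 * t ^ 2)` is invertible, as its constant term is `2`. -/
theorem isUnit_bgfDenominator :
    IsUnit (1 - 2 * PowerSeries.C (Polynomial.X : ℚ[X]) * PowerSeries.X +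
      formalSqrt (1 - 4 * PowerSeries.X ^ 2)) := by
  rw [PowerSeries.isUnit_iff_constantCoeff]
  rw [map_add, constantCoeff_formalSqrt _ (by simp)]
  have h : PowerSeries.constantCoeff
      (1 - 2 * PowerSeries.C (Polynomial.X : ℚ[X]) * PowerSeries.X) + 1 = Polynomial.C (2 : ℚ) := by
    simp
    norm_num
    rfl
  rw [h, Polynomial.isUnit_C]
  norm_num

/-! Refine the count by the image of the least point `0`, and delete the cycle through it. If `0` is
fixed, one point goes, with weight x. If `0` is swapped with `v.succ`, two points go, and the
smaller involution may be any pattern-avoider whose own value at `0` is at least `v` (for 321) or at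
most `v` (for 132): `avoids321_insertTwoCycle_iff`, `avoids132_insertTwoCycle_iff`.

With `poly321 (n + h) h` and `poly132 (n + h) n` as unknowns, both recursions become f(n+1, h+1) =
f(n, h+2) + f(n, h), which counts nonnegative ±1 paths with n steps from height h. For 321 the path
ends at height 0 and may take level steps of weight x at height 0. For 132 there are no level steps
and an end at height h has weight x^h.

Let z = t + t z² be the series of first passages one level down, and F = 1/(1 - xt - tz).
Decomposing at the first visit to 0 gives F z^h for 321. For 132, paths from h + 1 either avoid 0,
which contributes x times the series for h, or reach it, which contributes F z^(h+1). Both series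
are F at h = 0, and 2tz = 1 - √(1 - 4t²) puts F in the required form. The pattern 213 reduces to 132
by reverse-complement. -/

/-! ### Inserting a two-cycle through the least point -/

section InsertTwoCycle

/-- The order embedding of `Fin m` into `Fin (m + 2)` whose range omits `0` and `v.succ`. -/
def skipTwo {m : ℕ} (v : Fin (m + 1)) (i : Fin m) : Fin (m + 2) := (v.succAbove i).succ

theorem skipTwo_strictMono {m : ℕ} (v : Fin (m + 1)) : StrictMono (skipTwo v) := fun _ _ h =>
  Fin.succ_lt_succ_iff.2 (Fin.strictMono_succAbove v h)

theorem skipTwo_val {m : ℕ} (v : Fin (m + 1)) (i : Fin m) :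
    (skipTwo v i).val = if i.val < v.val then i.val + 1 else i.val + 2 := by
  simp only [skipTwo, Fin.succAbove, Fin.lt_def, Fin.val_castSucc, Fin.val_succ]
  split_ifs <;> simp

theorem eq_skipTwo_cases {m : ℕ} (v : Fin (m + 1)) (a : Fin (m + 2)) :
    a = 0 ∨ a = v.succ ∨ ∃ i, a = skipTwo v i := by
  rcases Fin.eq_zero_or_eq_succ a with rfl | ⟨b, rfl⟩
  · exact Or.inl rfl
  · rcases Fin.eq_self_or_eq_succAbove v b with rfl | ⟨i, rfl⟩
    · exact Or.inr (Or.inl rfl)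
    · exact Or.inr (Or.inr ⟨i, rfl⟩)

/-- The map on `Fin (m + 2)` that swaps `0` and `v.succ` and acts as `f` on the other points. -/
def insertTwoCycleFun {m : ℕ} (v : Fin (m + 1)) (f : Fin m → Fin m) : Fin (m + 2) → Fin (m + 2) :=
  Fin.cons v.succ (v.insertNth (α := fun _ => Fin (m + 2)) 0 fun i => skipTwo v (f i))

theorem insertTwoCycleFun_zero {m : ℕ} (v : Fin (m + 1)) (f : Fin m → Fin m) :
    insertTwoCycleFun v f 0 = v.succ := rfl

theorem insertTwoCycleFun_succ {m : ℕ} (v : Fin (m + 1)) (f : Fin m → Fin m) :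
    insertTwoCycleFun v f v.succ = 0 := by
  simp [insertTwoCycleFun]

theorem insertTwoCycleFun_skipTwo {m : ℕ} (v : Fin (m + 1)) (f : Fin m → Fin m) (i : Fin m) :
    insertTwoCycleFun v f (skipTwo v i) = skipTwo v (f i) := by
  simp [insertTwoCycleFun, skipTwo]

theorem insertTwoCycleFun_leftInverse {m : ℕ} (v : Fin (m + 1)) {f g : Fin m → Fin m}
    (h : Function.LeftInverse f g) :
    Function.LeftInverse (insertTwoCycleFun v f) (insertTwoCycleFun v g) := by
  intro a
  rcases eq_skipTwo_cases v a with rfl | rfl | ⟨i, rfl⟩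
  · rw [insertTwoCycleFun_zero, insertTwoCycleFun_succ]
  · rw [insertTwoCycleFun_succ, insertTwoCycleFun_zero]
  · rw [insertTwoCycleFun_skipTwo, insertTwoCycleFun_skipTwo, h]

/-- The permutation of `Fin (m + 2)` that swaps `0` and `v.succ` and acts as `σ` on the other
points. -/
def insertTwoCycle {m : ℕ} (v : Fin (m + 1)) (σ : Equiv.Perm (Fin m)) :
    Equiv.Perm (Fin (m + 2)) where
  toFun := insertTwoCycleFun v σ
  invFun := insertTwoCycleFun v σ.symm
  left_inv := insertTwoCycleFun_leftInverse v σ.symm_apply_apply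
  right_inv := insertTwoCycleFun_leftInverse v σ.apply_symm_apply

theorem insertTwoCycle_zero {m : ℕ} (v : Fin (m + 1)) (σ : Equiv.Perm (Fin m)) :
    insertTwoCycle v σ 0 = v.succ := rfl

theorem insertTwoCycle_succ {m : ℕ} (v : Fin (m + 1)) (σ : Equiv.Perm (Fin m)) :
    insertTwoCycle v σ v.succ = 0 := insertTwoCycleFun_succ v σ

theorem insertTwoCycle_skipTwo {m : ℕ} (v : Fin (m + 1)) (σ : Equiv.Perm (Fin m)) (i : Fin m) :
    insertTwoCycle v σ (skipTwo v i) = skipTwo v (σ i) := insertTwoCycleFun_skipTwo v σ i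

theorem insertTwoCycle_injective {m : ℕ} (v : Fin (m + 1)) :
    Function.Injective (insertTwoCycle v) := by
  intro σ ρ h
  ext i : 1
  apply (skipTwo_strictMono v).injective
  rw [← insertTwoCycle_skipTwo, h, insertTwoCycle_skipTwo]

theorem insertTwoCycle_involutive {m : ℕ} {v : Fin (m + 1)} {σ : Equiv.Perm (Fin m)} :
    Function.Involutive (insertTwoCycle v σ) ↔ Function.Involutive σ := by
  refine ⟨fun h i => (skipTwo_strictMono v).injective ?_, fun h => insertTwoCycleFun_leftInverse v h⟩
  rw [← insertTwoCycle_skipTwo, ← insertTwoCycle_skipTwo, h]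

theorem exists_insertTwoCycle {m : ℕ} {v : Fin (m + 1)} {σ : Equiv.Perm (Fin (m + 2))}
    (h : Function.Involutive σ) (h0 : σ 0 = v.succ) : ∃ ρ, insertTwoCycle v ρ = σ := by
  have h1 : σ v.succ = 0 := by rw [← h0, h]
  have key : ∀ i, ∃ j, σ (skipTwo v i) = skipTwo v j := by
    intro i
    rcases eq_skipTwo_cases v (σ (skipTwo v i)) with e | e | e
    · rw [← h1] at e
      exact absurd (Fin.succ_injective _ (σ.injective e)) (Fin.succAbove_ne v i)
    · rw [← h0] at e
      exact absurd (σ.injective e) (Fin.succ_ne_zero _)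
    · exact e
  choose g hg using key
  have hg' : Function.Involutive g := fun i => (skipTwo_strictMono v).injective (by
    rw [← hg, ← hg, h])
  refine ⟨hg'.toPerm, ?_⟩
  ext a : 1
  rcases eq_skipTwo_cases v a with rfl | rfl | ⟨i, rfl⟩
  · rw [insertTwoCycle_zero, h0]
  · rw [insertTwoCycle_succ, h1]
  · rw [insertTwoCycle_skipTwo, hg]
    rfl

theorem numFixedPoints_insertTwoCycle {m : ℕ} (v : Fin (m + 1)) (σ : Equiv.Perm (Fin m)) :
    numFixedPoints (insertTwoCycle v σ) = numFixedPoints σ := by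
  symm
  refine Finset.card_bij (fun i _ => skipTwo v i) ?_ (fun _ _ _ _ e =>
    (skipTwo_strictMono v).injective e) ?_
  · intro i hi
    simp only [Finset.mem_filter, Finset.mem_univ, true_and] at hi ⊢
    rw [insertTwoCycle_skipTwo, hi]
  · intro a ha
    simp only [Finset.mem_filter, Finset.mem_univ, true_and] at ha
    rcases eq_skipTwo_cases v a with rfl | rfl | ⟨i, rfl⟩
    · exact absurd ha (Fin.succ_ne_zero _)
    · rw [insertTwoCycle_succ] at ha
      exact absurd ha.symm (Fin.succ_ne_zero _)
    · rw [insertTwoCycle_skipTwo] at ha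
      exact ⟨i, by simpa using (skipTwo_strictMono v).injective ha, rfl⟩

end InsertTwoCycle

/-! ### Inserting a least fixed point -/

section InsertZero

/-- The permutation of `Fin (m + 1)` that fixes `0` and acts as `σ` on the other points. -/
def insertZero {m : ℕ} (σ : Equiv.Perm (Fin m)) : Equiv.Perm (Fin (m + 1)) :=
  Equiv.Perm.decomposeFin.symm (0, σ)

theorem insertZero_zero {m : ℕ} (σ : Equiv.Perm (Fin m)) : insertZero σ 0 = 0 := by
  simp [insertZero]

theorem insertZero_succ {m : ℕ} (σ : Equiv.Perm (Fin m)) (i : Fin m) :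
    insertZero σ i.succ = (σ i).succ := by
  simp [insertZero]

theorem insertZero_injective {m : ℕ} : Function.Injective (insertZero (m := m)) := by
  intro σ ρ h
  ext i : 1
  apply Fin.succ_injective
  rw [← insertZero_succ, h, insertZero_succ]

theorem exists_insertZero {m : ℕ} {σ : Equiv.Perm (Fin (m + 1))} (h : σ 0 = 0) :
    ∃ ρ, insertZero ρ = σ := by
  obtain ⟨⟨p, ρ⟩, rfl⟩ := Equiv.Perm.decomposeFin.symm.surjective σ
  rw [Equiv.Perm.decomposeFin_symm_apply_zero] at h
  exact ⟨ρ, by rw [h]; rfl⟩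

theorem insertZero_involutive {m : ℕ} {σ : Equiv.Perm (Fin m)} :
    Function.Involutive (insertZero σ) ↔ Function.Involutive σ := by
  refine ⟨fun h i => Fin.succ_injective _ ?_, fun h a => ?_⟩
  · rw [← insertZero_succ, ← insertZero_succ, h]
  · rcases Fin.eq_zero_or_eq_succ a with rfl | ⟨b, rfl⟩
    · rw [insertZero_zero, insertZero_zero]
    · rw [insertZero_succ, insertZero_succ, h]

theorem numFixedPoints_insertZero {m : ℕ} (σ : Equiv.Perm (Fin m)) :
    numFixedPoints (insertZero σ) = numFixedPoints σ + 1 := by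
  simp [numFixedPoints, Fin.univ_succ, Finset.filter_insert, insertZero_zero, Finset.filter_map,
    insertZero_succ]

end InsertZero

/-! ### Fixed point enumerators and their transfer along insertions and conjugation -/

section FixedPointPolynomial

open Classical in
/-- The fixed point enumerator `∑ x ^ fp(σ)` over the permutations `σ` with property `P`. -/
noncomputable def fixedPointPoly {m : ℕ} (P : Equiv.Perm (Fin m) → Prop) : ℚ[X] :=
  ∑ σ with P σ, (Polynomial.X : ℚ[X]) ^ numFixedPoints σ

theorem fixedPointPoly_congr {m : ℕ} {P Q : Equiv.Perm (Fin m) → Prop} (h : ∀ σ, P σ ↔ Q σ) :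
    fixedPointPoly P = fixedPointPoly Q := by
  rw [show P = Q from funext fun σ => propext (h σ)]

theorem fixedPointPoly_eq_zero {m : ℕ} {P : Equiv.Perm (Fin m) → Prop} (h : ∀ σ, ¬ P σ) :
    fixedPointPoly P = 0 := by
  simp [fixedPointPoly, h]

theorem fixedPointPoly_eq_one {m : ℕ} {P : Equiv.Perm (Fin m) → Prop} (h : ∀ σ, P σ ↔ σ = 1) :
    fixedPointPoly P = Polynomial.X ^ m := by
  rw [fixedPointPoly]
  simp [h, numFixedPoints, Finset.filter_eq']

theorem fixedPointPoly_split {m : ℕ} (P Q : Equiv.Perm (Fin m) → Prop) :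
    fixedPointPoly P =
      fixedPointPoly (fun σ => P σ ∧ Q σ) + fixedPointPoly (fun σ => P σ ∧ ¬ Q σ) := by
  classical
  simp only [fixedPointPoly]
  rw [← Finset.sum_filter_add_sum_filter_not _ Q, Finset.filter_filter, Finset.filter_filter]

theorem fixedPointPoly_insertTwoCycle {m : ℕ} (v : Fin (m + 1))
    {P : Equiv.Perm (Fin (m + 2)) → Prop} {P' : Equiv.Perm (Fin m) → Prop}
    (hP : ∀ σ, P σ → Function.Involutive σ ∧ σ 0 = v.succ)
    (h : ∀ σ, P (insertTwoCycle v σ) ↔ P' σ) : fixedPointPoly P = fixedPointPoly P' := by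
  classical
  symm
  refine Finset.sum_bij (fun σ _ => insertTwoCycle v σ) ?_ (fun _ _ _ _ e =>
    insertTwoCycle_injective v e) ?_ ?_
  · intro σ hσ
    simpa [h] using hσ
  · intro σ hσ
    simp only [Finset.mem_filter, Finset.mem_univ, true_and] at hσ
    obtain ⟨ρ, rfl⟩ := exists_insertTwoCycle (hP σ hσ).1 (hP σ hσ).2
    exact ⟨ρ, by simpa [h] using hσ, rfl⟩
  · intro σ _
    rw [numFixedPoints_insertTwoCycle]

theorem fixedPointPoly_insertZero {m : ℕ}
    {P : Equiv.Perm (Fin (m + 1)) → Prop} {P' : Equiv.Perm (Fin m) → Prop}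
    (hP : ∀ σ, P σ → σ 0 = 0)
    (h : ∀ σ, P (insertZero σ) ↔ P' σ) :
    fixedPointPoly P = Polynomial.X * fixedPointPoly P' := by
  classical
  rw [fixedPointPoly, fixedPointPoly, Finset.mul_sum]
  symm
  refine Finset.sum_bij (fun σ _ => insertZero σ) ?_ (fun _ _ _ _ e =>
    insertZero_injective e) ?_ ?_
  · intro σ hσ
    simpa [h] using hσ
  · intro σ hσ
    simp only [Finset.mem_filter, Finset.mem_univ, true_and] at hσ
    obtain ⟨ρ, rfl⟩ := exists_insertZero (hP σ hσ)
    exact ⟨ρ, by simpa [h] using hσ, rfl⟩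
  · intro σ _
    rw [numFixedPoints_insertZero, pow_succ']

theorem fixedPointPoly_conj {m : ℕ} (e : Equiv.Perm (Fin m)) (P : Equiv.Perm (Fin m) → Prop) :
    fixedPointPoly (fun σ => P (e * σ * e⁻¹)) = fixedPointPoly P := by
  classical
  refine Finset.sum_bij (fun σ _ => e * σ * e⁻¹) ?_ ?_ ?_ ?_
  · intro σ hσ
    simpa using hσ
  · intro σ _ ρ _ h
    simpa using h
  · intro σ hσ
    exact ⟨e⁻¹ * σ * e, by simpa [mul_assoc] using hσ, by simp [mul_assoc]⟩
  · intro σ _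
    congr 1
    refine Finset.card_bij (fun i _ => e i) ?_ (fun _ _ _ _ h => e.injective h) ?_
    · intro i hi
      simp only [Finset.mem_filter, Finset.mem_univ, true_and] at hi ⊢
      simp [Equiv.Perm.mul_apply, hi]
    · intro i hi
      refine ⟨e⁻¹ i, ?_, by simp⟩
      exact Finset.mem_filter.2 ⟨Finset.mem_univ _,
        Equiv.Perm.eq_inv_iff_eq.2 (Finset.mem_filter.1 hi).2⟩

end FixedPointPolynomial

/-! ### Pattern avoidance under insertion -/

section Patterns

/-- `σ` has no occurrence of the pattern `321`. -/
def Avoids321 {m : ℕ} (σ : Equiv.Perm (Fin m)) : Prop :=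
  ∀ a b c, a < b → b < c → σ b < σ a → σ c < σ b → False

/-- `σ` has no occurrence of the pattern `132`. -/
def Avoids132 {m : ℕ} (σ : Equiv.Perm (Fin m)) : Prop :=
  ∀ a b c, a < b → b < c → σ a < σ c → σ c < σ b → False

theorem strictMono_triple {m : ℕ} {a b c : Fin m} (hab : a < b) (hbc : b < c) :
    StrictMono ![a, b, c] := by
  rw [Fin.strictMono_iff_lt_succ]
  intro i
  fin_cases i
  · exact hab
  · exact hbc

theorem avoidsPattern_321_iff {m : ℕ} (σ : Equiv.Perm (Fin m)) {τ : Equiv.Perm (Fin 3)}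
    (hτ : ⇑τ = ![2, 1, 0]) : AvoidsPattern σ τ ↔ Avoids321 σ := by
  rw [AvoidsPattern, ContainsPattern, hτ]
  constructor
  · intro h a b c hab hbc h1 h2
    refine h ⟨![a, b, c], strictMono_triple hab hbc, fun i j => ?_⟩
    have h3 := h2.trans h1
    fin_cases i <;> fin_cases j <;> simp [h1, h2, h3, h1.le, h2.le, h3.le]
  · rintro h ⟨i, hi, H⟩
    exact h (i 0) (i 1) (i 2) (hi (by decide)) (hi (by decide)) ((H 1 0).2 (by decide))
      ((H 2 1).2 (by decide))

theorem avoidsPattern_132_iff {m : ℕ} (σ : Equiv.Perm (Fin m)) {τ : Equiv.Perm (Fin 3)}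
    (hτ : ⇑τ = ![0, 2, 1]) : AvoidsPattern σ τ ↔ Avoids132 σ := by
  rw [AvoidsPattern, ContainsPattern, hτ]
  constructor
  · intro h a b c hab hbc h1 h2
    refine h ⟨![a, b, c], strictMono_triple hab hbc, fun i j => ?_⟩
    have h3 := h1.trans h2
    fin_cases i <;> fin_cases j <;> simp [h1, h2, h3, h1.le, h2.le, h3.le]
  · rintro h ⟨i, hi, H⟩
    exact h (i 0) (i 1) (i 2) (hi (by decide)) (hi (by decide)) ((H 0 2).2 (by decide))
      ((H 2 1).2 (by decide))

/-- Conjugation by the order reversal reverses both positions and values, which turns 213 into 132.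
-/
theorem avoidsPattern_213_iff {m : ℕ} (σ : Equiv.Perm (Fin m)) {τ : Equiv.Perm (Fin 3)}
    (hτ : ⇑τ = ![1, 0, 2]) :
    AvoidsPattern σ τ ↔ Avoids132 (Fin.revPerm * σ * Fin.revPerm⁻¹) := by
  rw [AvoidsPattern, ContainsPattern, hτ]
  have hr : ∀ i : Fin m, (Fin.revPerm * σ * Fin.revPerm⁻¹ : Equiv.Perm (Fin m)) i = Fin.rev (σ (Fin.rev i)) :=
    fun i => rfl
  simp only [Avoids132, hr, Fin.rev_lt_rev]
  constructor
  · intro h a b c hab hbc h1 h2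
    refine h ⟨![c.rev, b.rev, a.rev], strictMono_triple (Fin.rev_lt_rev.2 hbc)
      (Fin.rev_lt_rev.2 hab), fun i j => ?_⟩
    have h3 := h2.trans h1
    fin_cases i <;> fin_cases j <;> simp [h1, h2, h3, h1.le, h2.le, h3.le]
  · rintro h ⟨i, hi, H⟩
    refine h (i 2).rev (i 1).rev (i 0).rev (Fin.rev_lt_rev.2 (hi (by decide)))
      (Fin.rev_lt_rev.2 (hi (by decide))) ?_ ?_
    · simpa using (H 0 2).2 (by decide)
    · simpa using (H 1 0).2 (by decide)

theorem avoids321_insertZero {m : ℕ} {σ : Equiv.Perm (Fin m)} :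
    Avoids321 (insertZero σ) ↔ Avoids321 σ := by
  constructor
  · intro h a b c hab hbc h1 h2
    exact h a.succ b.succ c.succ (by simpa) (by simpa) (by simpa [insertZero_succ])
      (by simpa [insertZero_succ])
  · intro h a b c hab hbc h1 h2
    rcases Fin.eq_zero_or_eq_succ a with rfl | ⟨a, rfl⟩
    · rw [insertZero_zero] at h1
      exact absurd h1 (Fin.not_lt_zero _)
    obtain ⟨b, rfl⟩ := Fin.exists_succ_eq.2 (Fin.ne_zero_of_lt hab)
    obtain ⟨c, rfl⟩ := Fin.exists_succ_eq.2 (Fin.ne_zero_of_lt hbc)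
    simp only [insertZero_succ, Fin.succ_lt_succ_iff] at hab hbc h1 h2
    exact h a b c hab hbc h1 h2

theorem Avoids321.of_insertTwoCycle {m : ℕ} {v : Fin (m + 1)} {σ : Equiv.Perm (Fin m)}
    (h : Avoids321 (insertTwoCycle v σ)) : Avoids321 σ := by
  intro a b c hab hbc h1 h2
  have e := skipTwo_strictMono v
  refine h _ _ _ (e hab) (e hbc) ?_ ?_ <;> simpa only [insertTwoCycle_skipTwo, e.lt_iff_lt]

theorem Avoids132.of_insertTwoCycle {m : ℕ} {v : Fin (m + 1)} {σ : Equiv.Perm (Fin m)}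
    (h : Avoids132 (insertTwoCycle v σ)) : Avoids132 σ := by
  intro a b c hab hbc h1 h2
  have e := skipTwo_strictMono v
  refine h _ _ _ (e hab) (e hbc) ?_ ?_ <;> simpa only [insertTwoCycle_skipTwo, e.lt_iff_lt]

theorem skipTwo_lt_succ {m : ℕ} {v : Fin (m + 1)} {i : Fin m} :
    skipTwo v i < v.succ ↔ i.val < v.val := by
  rw [Fin.lt_def, skipTwo_val, Fin.val_succ]
  split_ifs <;> omega

theorem succ_lt_skipTwo {m : ℕ} {v : Fin (m + 1)} {i : Fin m} :
    v.succ < skipTwo v i ↔ v.val ≤ i.val := by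
  rw [Fin.lt_def, skipTwo_val, Fin.val_succ]
  split_ifs <;> omega

/-- If the old first value is below `v`, it forms a 321 with the two inserted points. Otherwise any
321 using an inserted point yields one in `σ`, led by the large old first value. -/
theorem avoids321_insertTwoCycle_iff {m : ℕ} {v : Fin (m + 1)} {σ : Equiv.Perm (Fin m)}
    (hσ : Function.Involutive σ) :
    Avoids321 (insertTwoCycle v σ) ↔
      Avoids321 σ ∧ ∀ i : Fin m, i.val = 0 → v.val ≤ (σ i).val := by
  have e := skipTwo_strictMono v
  constructor
  · refine fun h => ⟨h.of_insertTwoCycle, fun i hi => ?_⟩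
    by_contra! hv
    refine h 0 (skipTwo v i) v.succ (Fin.succ_pos _) (skipTwo_lt_succ.2 (by omega)) ?_ ?_
    · rw [insertTwoCycle_zero, insertTwoCycle_skipTwo]
      exact skipTwo_lt_succ.2 hv
    · rw [insertTwoCycle_succ, insertTwoCycle_skipTwo]
      exact Fin.succ_pos _
  · rintro ⟨h, h0⟩
    -- Rules out the new `0` as the "3" with two old points: the old `0` could replace it.
    have hval : ∀ i j, i < j → (σ i).val < v.val → σ j < σ i → False := by
      intro i j hij hi hji
      have hz := h0 ⟨0, by omega⟩ rfl
      refine h ⟨0, by omega⟩ i j ?_ hij ?_ hji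
      · rw [Fin.lt_def]
        by_contra! h'
        have : i = ⟨0, by omega⟩ := Fin.ext (by simpa using h')
        rw [← this] at hz
        omega
      · rw [Fin.lt_def]
        omega
    -- The mirror case, `v.succ` as the last position, obtained by exchanging positions and values
    -- through the involution.
    have hpos : ∀ i j, i < j → j.val < v.val → σ j < σ i → False := by
      intro i j hij hj hji
      exact hval _ _ hji (by rwa [hσ]) (by rwa [hσ, hσ])
    -- Both inserted points are used: the old cycle of `0` and `σ 0` encloses `i` in the same way.
    have hmid : ∀ i : Fin m, i.val < v.val → (σ i).val < v.val → False := by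
      intro i hi hi'
      have hz := h0 ⟨0, by omega⟩ rfl
      set z : Fin m := ⟨0, by omega⟩
      have hne : σ i ≠ z := fun e => by
        rw [← e, hσ] at hz
        omega
      have hne' : i ≠ z := fun e => by
        rw [e] at hi'
        omega
      refine h z i (σ z) ?_ ?_ ?_ ?_
      · exact Fin.lt_def.2 (Nat.pos_of_ne_zero fun e => hne' (Fin.ext e))
      · exact Fin.lt_def.2 (by omega)
      · exact Fin.lt_def.2 (by omega)
      · rw [hσ]
        exact Fin.lt_def.2 (Nat.pos_of_ne_zero fun e => hne (Fin.ext e))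
    intro a b c hab hbc h1 h2
    rcases eq_skipTwo_cases v b with rfl | rfl | ⟨j, rfl⟩
    · exact Fin.not_lt_zero _ hab
    · rw [insertTwoCycle_succ] at h2
      exact Fin.not_lt_zero _ h2
    rw [insertTwoCycle_skipTwo] at h1 h2
    rcases eq_skipTwo_cases v a with rfl | rfl | ⟨i, rfl⟩
    · rw [insertTwoCycle_zero, skipTwo_lt_succ] at h1
      rcases eq_skipTwo_cases v c with rfl | rfl | ⟨k, rfl⟩
      · exact Fin.not_lt_zero _ hbc
      · exact hmid j (skipTwo_lt_succ.1 hbc) h1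
      · rw [insertTwoCycle_skipTwo, e.lt_iff_lt] at h2
        exact hval _ _ (e.lt_iff_lt.1 hbc) h1 h2
    · rw [insertTwoCycle_succ] at h1
      exact Fin.not_lt_zero _ h1
    rw [insertTwoCycle_skipTwo, e.lt_iff_lt] at h1
    rcases eq_skipTwo_cases v c with rfl | rfl | ⟨k, rfl⟩
    · exact Fin.not_lt_zero _ hbc
    · exact hpos _ _ (e.lt_iff_lt.1 hab) (skipTwo_lt_succ.1 hbc) h1
    · rw [insertTwoCycle_skipTwo, e.lt_iff_lt] at h2
      exact h _ _ _ (e.lt_iff_lt.1 hab) (e.lt_iff_lt.1 hbc) h1 h2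

/-- An inserted point can only play the "1" of a 132. When the old first value is at most `v`, the
old `0` can take over that role. -/
theorem avoids132_insertTwoCycle_iff {m : ℕ} {v : Fin (m + 1)} {σ : Equiv.Perm (Fin m)}
    (hσ : Function.Involutive σ) :
    Avoids132 (insertTwoCycle v σ) ↔
      Avoids132 σ ∧ ∀ i : Fin m, i.val = 0 → (σ i).val ≤ v.val := by
  have e := skipTwo_strictMono v
  constructor
  · refine fun h => ⟨h.of_insertTwoCycle, fun i hi => ?_⟩
    by_contra! hv
    -- The old value `w` is relabelled `v + 2`, strictly between the inserted value `v + 1` and the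
    -- new label of `σ i`, so it serves as the "2".
    set w : Fin m := ⟨v.val, by omega⟩ with hw
    have hwi : σ w ≠ i := fun e => by
      rw [← e, hσ] at hv
      exact lt_irrefl _ hv
    refine h 0 (skipTwo v i) (skipTwo v (σ w)) (Fin.succ_pos _) (e ?_) ?_ ?_
    · rw [Fin.lt_def, hi]
      exact Nat.pos_of_ne_zero fun e => hwi (Fin.ext (e.trans hi.symm))
    · rw [insertTwoCycle_zero, insertTwoCycle_skipTwo, hσ]
      exact succ_lt_skipTwo.2 le_rfl
    · rw [insertTwoCycle_skipTwo, insertTwoCycle_skipTwo, hσ]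
      exact e hv
  · rintro ⟨h, h0⟩
    have hval : ∀ i j, i < j → v.val ≤ (σ j).val → σ j < σ i → False := by
      intro i j hij hj hji
      have hz := h0 ⟨0, by omega⟩ rfl
      have hi : 0 < i.val := by
        by_contra! h'
        have : i = ⟨0, by omega⟩ := Fin.ext (by simpa using h')
        rw [← this] at hz
        omega
      refine h ⟨0, by omega⟩ i j hi hij (lt_of_le_of_ne (hz.trans hj) fun e => ?_) hji
      rw [← σ.injective e] at hij
      exact absurd hij (Nat.not_lt_zero _)
    have hpos : ∀ i j, i < j → v.val ≤ i.val → σ j < σ i → False := by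
      intro i j hij hi hji
      exact hval _ _ hji (by rwa [hσ]) (by rwa [hσ, hσ])
    intro a b c hab hbc h1 h2
    rcases eq_skipTwo_cases v b with rfl | rfl | ⟨j, rfl⟩
    · exact Fin.not_lt_zero _ hab
    · rw [insertTwoCycle_succ] at h2
      exact Fin.not_lt_zero _ h2
    rcases eq_skipTwo_cases v c with rfl | rfl | ⟨k, rfl⟩
    · exact Fin.not_lt_zero _ hbc
    · rw [insertTwoCycle_succ] at h1
      exact Fin.not_lt_zero _ h1
    rw [insertTwoCycle_skipTwo, insertTwoCycle_skipTwo, e.lt_iff_lt] at h2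
    rw [insertTwoCycle_skipTwo] at h1
    rw [e.lt_iff_lt] at hbc
    rcases eq_skipTwo_cases v a with rfl | rfl | ⟨i, rfl⟩
    · rw [insertTwoCycle_zero, succ_lt_skipTwo] at h1
      exact hval _ _ hbc h1 h2
    · exact hpos _ _ hbc (succ_lt_skipTwo.1 hab) h2
    · rw [insertTwoCycle_skipTwo, e.lt_iff_lt] at h1
      exact h _ _ _ (e.lt_iff_lt.1 hab) hbc h1 h2

end Patterns

/-! ### Recurrences refined by the image of the least point -/

section Recurrences

/-- The fixed point enumerator of the `321`-avoiding involutions `σ` with `k ≤ σ 0`. -/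
noncomputable def poly321 (m k : ℕ) : ℚ[X] :=
  fixedPointPoly fun σ : Equiv.Perm (Fin m) =>
    (Function.Involutive σ ∧ Avoids321 σ) ∧ ∀ i : Fin m, i.val = 0 → k ≤ (σ i).val

/-- The fixed point enumerator of the `132`-avoiding involutions `σ` with `σ 0 ≤ k`. -/
noncomputable def poly132 (m k : ℕ) : ℚ[X] :=
  fixedPointPoly fun σ : Equiv.Perm (Fin m) =>
    (Function.Involutive σ ∧ Avoids132 σ) ∧ ∀ i : Fin m, i.val = 0 → (σ i).val ≤ k

/-- The quantified condition on the first value also makes sense for the empty permutation, where it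
is vacuous. -/
theorem forall_val_eq_zero_iff {m : ℕ} {p : Fin (m + 1) → Prop} :
    (∀ i : Fin (m + 1), i.val = 0 → p i) ↔ p 0 :=
  ⟨fun h => h 0 rfl, fun h i hi => by rwa [show i = 0 from Fin.ext hi]⟩

theorem poly321_add_two {m k : ℕ} (hk : k ≤ m) :
    poly321 (m + 2) (k + 1) = poly321 (m + 2) (k + 2) + poly321 m k := by
  rw [poly321, fixedPointPoly_split _ fun σ => k + 2 ≤ (σ 0).val]
  congr 1
  · refine fixedPointPoly_congr fun σ => ?_
    rw [forall_val_eq_zero_iff, forall_val_eq_zero_iff, and_assoc]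
    refine and_congr_right fun _ => ?_
    omega
  · refine fixedPointPoly_insertTwoCycle ⟨k, by omega⟩ ?_ ?_
    · rintro σ ⟨⟨⟨hσ, -⟩, h1⟩, h2⟩
      rw [forall_val_eq_zero_iff] at h1
      exact ⟨hσ, Fin.ext (by simp only [Fin.val_succ]; omega)⟩
    · intro σ
      rw [forall_val_eq_zero_iff, insertTwoCycle_zero, insertTwoCycle_involutive]
      simp only [Fin.val_succ]
      constructor
      · rintro ⟨⟨⟨hσ, h⟩, -⟩, -⟩
        have := (avoids321_insertTwoCycle_iff hσ).1 h
        exact ⟨⟨hσ, this.1⟩, this.2⟩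
      · rintro ⟨⟨hσ, h⟩, h0⟩
        exact ⟨⟨⟨hσ, (avoids321_insertTwoCycle_iff hσ).2 ⟨h, h0⟩⟩, by omega⟩, by omega⟩

theorem poly321_succ_zero (m : ℕ) :
    poly321 (m + 1) 0 = poly321 (m + 1) 1 + Polynomial.X * poly321 m 0 := by
  rw [poly321, fixedPointPoly_split _ fun σ => 1 ≤ (σ 0).val]
  congr 1
  · refine fixedPointPoly_congr fun σ => ?_
    rw [forall_val_eq_zero_iff, forall_val_eq_zero_iff, and_assoc]
    refine and_congr_right fun _ => ?_
    omega
  · refine fixedPointPoly_insertZero ?_ ?_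
    · rintro σ ⟨-, h2⟩
      exact Fin.ext (by simp only [Fin.val_zero]; omega)
    · intro σ
      simp [insertZero_involutive, avoids321_insertZero, insertZero_zero]

theorem poly321_zero_zero : poly321 0 0 = 1 := by
  rw [poly321, fixedPointPoly_eq_one, pow_zero]
  intro σ
  refine iff_of_true ⟨⟨fun i => i.elim0, fun a => a.elim0⟩, fun i => i.elim0⟩ (Subsingleton.elim _ _)

theorem poly321_self_succ (k : ℕ) : poly321 (k + 1) (k + 1) = 0 := by
  refine fixedPointPoly_eq_zero fun σ h => ?_
  have := h.2 0 rfl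
  omega

theorem poly132_add_two {m k : ℕ} (hk : k ≤ m) :
    poly132 (m + 2) (k + 1) = poly132 (m + 2) k + poly132 m k := by
  rw [poly132, fixedPointPoly_split _ fun σ => (σ 0).val ≤ k]
  congr 1
  · refine fixedPointPoly_congr fun σ => ?_
    rw [forall_val_eq_zero_iff, forall_val_eq_zero_iff, and_assoc]
    refine and_congr_right fun _ => ?_
    omega
  · refine fixedPointPoly_insertTwoCycle ⟨k, by omega⟩ ?_ ?_
    · rintro σ ⟨⟨⟨hσ, -⟩, h1⟩, h2⟩
      rw [forall_val_eq_zero_iff] at h1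
      exact ⟨hσ, Fin.ext (by simp only [Fin.val_succ]; omega)⟩
    · intro σ
      rw [forall_val_eq_zero_iff, insertTwoCycle_zero, insertTwoCycle_involutive]
      simp only [Fin.val_succ]
      constructor
      · rintro ⟨⟨⟨hσ, h⟩, -⟩, -⟩
        have := (avoids132_insertTwoCycle_iff hσ).1 h
        exact ⟨⟨hσ, this.1⟩, this.2⟩
      · rintro ⟨⟨hσ, h⟩, h0⟩
        exact ⟨⟨⟨hσ, (avoids132_insertTwoCycle_iff hσ).2 ⟨h, h0⟩⟩, by omega⟩, by omega⟩

/-- Both bounds are vacuous, since values are at most `m - 1`. -/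
theorem poly132_eq_of_le {m k l : ℕ} (hk : m ≤ k + 1) (hl : m ≤ l + 1) :
    poly132 m k = poly132 m l :=
  fixedPointPoly_congr fun σ => and_congr_right fun _ => forall_congr' fun i => by
    have := (σ i).isLt
    exact ⟨fun _ _ => by omega, fun _ _ => by omega⟩

/-- With `0` fixed, any inversion completes to a 132 led by `0`, so `σ` is increasing. -/
theorem Avoids132.eq_one {m : ℕ} {σ : Equiv.Perm (Fin m)} (h : Avoids132 σ)
    (h0 : ∀ i : Fin m, i.val = 0 → (σ i).val ≤ 0) : σ = 1 := by
  have hm : StrictMono σ := by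
    intro i j hij
    by_contra! hji
    have hlt : σ j < σ i := lt_of_le_of_ne hji fun e => hij.ne' (σ.injective e)
    have hz := h0 ⟨0, by omega⟩ rfl
    have hi : 0 < i.val := by
      by_contra! h'
      have := h0 i (by omega)
      rw [Fin.lt_def] at hlt
      omega
    refine h ⟨0, by omega⟩ i j hi hij ?_ hlt
    rw [Fin.lt_def]
    refine Nat.lt_of_le_of_ne (by omega) fun e => ?_
    have := congrArg Fin.val (σ.injective (Fin.ext e))
    simp only [Fin.lt_def] at *
    omega
  have := Subsingleton.elim (hm.orderIsoOfSurjective σ σ.surjective) (OrderIso.refl _)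
  ext i : 1
  exact congrArg (fun f : Fin m ≃o Fin m => f i) this

theorem poly132_zero (m : ℕ) : poly132 m 0 = Polynomial.X ^ m := by
  refine fixedPointPoly_eq_one fun σ => ⟨fun h => h.1.2.eq_one h.2, ?_⟩
  rintro rfl
  refine ⟨⟨fun i => rfl, fun a b c _ hbc _ h2 => ?_⟩, fun i hi => hi.le⟩
  exact absurd (show c < b from h2) hbc.not_gt

end Recurrences

/-! ### Solving the recurrences by power series -/

section GeneratingFunctions

open PowerSeries

/-- The root (1 - s)/(2t) is taken in the rationalised form 2t/(1 + s), which needs no division by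
`t`. -/
theorem exists_quadratic_root_of_sq {R : Type*} [CommRing R] {s t : R}
    (hs : s ^ 2 = 1 - 4 * t ^ 2) (h1 : IsUnit (1 + s)) :
    ∃ z, z = t + t * z ^ 2 ∧ 2 * (t * z) = 1 - s := by
  obtain ⟨u, hu⟩ := h1.exists_right_inv
  refine ⟨2 * t * u, ?_, ?_⟩
  · have : (1 + s) ^ 2 * (2 * t * u - (t + t * (2 * t * u) ^ 2)) = 0 := by
      linear_combination (2 * t * (1 + s) - 4 * t ^ 3 * ((1 + s) * u + 1)) * hu - t * hs
    rw [← sub_eq_zero]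
    exact (h1.pow 2).mul_right_eq_zero.1 this
  · have : (1 + s) * (2 * (t * (2 * t * u)) - (1 - s)) = 0 := by
      linear_combination (4 * t ^ 2) * hu + hs
    rw [← sub_eq_zero]
    exact h1.mul_right_eq_zero.1 this

/-- The path recursion determines `f` from its values at n = 0; `c` is the weight of a level step at
height 0. -/
theorem coeff_eq_of_recurrence {f : ℕ → ℕ → ℚ[X]} {W : ℕ → PowerSeries ℚ[X]}
    (c : ℚ[X]) (h0 : ∀ h, f 0 h = constantCoeff (W h))
    (hf : ∀ n, f (n + 1) 0 = f n 1 + c * f n 0)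
    (hf' : ∀ n h, f (n + 1) (h + 1) = f n (h + 2) + f n h)
    (hW : W 0 = C (constantCoeff (W 0)) + X * (W 1 + C c * W 0))
    (hW' : ∀ h, W (h + 1) = C (constantCoeff (W (h + 1))) + X * (W (h + 2) + W h))
    (n h : ℕ) : f n h = coeff n (W h) := by
  induction n generalizing h with
  | zero => rw [h0, coeff_zero_eq_constantCoeff_apply]
  | succ n ih =>
    cases h with
    | zero =>
      rw [hf, hW, map_add, coeff_succ_X_mul, coeff_C, if_neg n.succ_ne_zero, zero_add, map_add,
        coeff_C_mul, ih, ih]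
    | succ h =>
      rw [hf', hW', map_add, coeff_succ_X_mul, coeff_C, if_neg n.succ_ne_zero, zero_add, map_add,
        ih, ih]

variable {F z : PowerSeries ℚ[X]}

theorem poly321_eq_coeff (hz : z = X + X * z ^ 2)
    (hF : F * (1 - C (Polynomial.X : ℚ[X]) * X - X * z) = 1) (n : ℕ) :
    poly321 n 0 = coeff n F := by
  have hz0 : constantCoeff z = 0 := by rw [hz]; simp
  have hF0 : constantCoeff F = 1 := by simpa using congrArg constantCoeff hF
  have key := coeff_eq_of_recurrence (f := fun n h => poly321 (n + h) h)
    (W := fun h => F * z ^ h) Polynomial.X ?_ ?_ ?_ ?_ ?_ n 0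
  · simpa using key
  · rintro (_ | h)
    · simpa [hF0] using poly321_zero_zero
    · simpa [hz0] using poly321_self_succ h
  · exact fun n => poly321_succ_zero n
  · intro n h
    have := poly321_add_two (m := n + h) (k := h) (by omega)
    rwa [show n + 1 + (h + 1) = n + h + 2 by ring, show n + (h + 2) = n + h + 2 by ring]
  · simp only [pow_zero, mul_one, pow_one, hF0, map_one]
    linear_combination hF
  · intro h
    simp only [map_mul, map_pow, hz0, zero_pow h.succ_ne_zero, mul_zero, map_zero, zero_add]
    linear_combination (F * z ^ h) * hz

/-- The power series `q 0 = F`, `q (h + 1) = x * q h + F * z ^ (h + 1)`. -/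
noncomputable def shiftedSeries (F z : PowerSeries ℚ[X]) : ℕ → PowerSeries ℚ[X]
  | 0 => F
  | h + 1 => C (Polynomial.X : ℚ[X]) * shiftedSeries F z h + F * z ^ (h + 1)

theorem shiftedSeries_zero (hF : F * (1 - C (Polynomial.X : ℚ[X]) * X - X * z) = 1) :
    shiftedSeries F z 0 = 1 + X * shiftedSeries F z 1 := by
  simp only [shiftedSeries]
  linear_combination hF

theorem shiftedSeries_succ (hz : z = X + X * z ^ 2)
    (hF : F * (1 - C (Polynomial.X : ℚ[X]) * X - X * z) = 1) (h : ℕ) :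
    shiftedSeries F z (h + 1) = C (Polynomial.X : ℚ[X]) ^ (h + 1) +
      X * (shiftedSeries F z (h + 2) + shiftedSeries F z h) := by
  induction h with
  | zero =>
    simp only [shiftedSeries]
    linear_combination C (Polynomial.X : ℚ[X]) * hF + F * hz
  | succ h ih =>
    have e1 : shiftedSeries F z (h + 1 + 1) =
      C (Polynomial.X : ℚ[X]) * shiftedSeries F z (h + 1) + F * z ^ (h + 2) := rfl
    have e2 : shiftedSeries F z (h + 1 + 2) =
      C (Polynomial.X : ℚ[X]) * shiftedSeries F z (h + 2) + F * z ^ (h + 3) := rfl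
    have e3 : shiftedSeries F z (h + 1) =
      C (Polynomial.X : ℚ[X]) * shiftedSeries F z h + F * z ^ (h + 1) := rfl
    linear_combination e1 + C (Polynomial.X : ℚ[X]) * ih - X * e2 - X * e3 + F * z ^ (h + 1) * hz

theorem poly132_eq_coeff (hz : z = X + X * z ^ 2)
    (hF : F * (1 - C (Polynomial.X : ℚ[X]) * X - X * z) = 1) (n : ℕ) :
    poly132 n n = coeff n F := by
  have h0 : ∀ h, constantCoeff (shiftedSeries F z h) = Polynomial.X ^ h := by
    rintro (_ | h)
    · rw [shiftedSeries_zero hF]; simp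
    · rw [shiftedSeries_succ hz hF]; simp
  -- No level steps here: at height 0 the bounds `n + 1` and `n` are both vacuous, hence `c = 0`.
  have key := coeff_eq_of_recurrence (f := fun n h => poly132 (n + h) n)
    (W := shiftedSeries F z) 0 ?_ ?_ ?_ ?_ ?_ n 0
  · simpa [shiftedSeries] using key
  · intro h
    simpa [h0] using poly132_zero h
  · intro n
    simpa using poly132_eq_of_le (m := n + 1) (k := n + 1) (l := n) (by omega) (by omega)
  · intro n h
    have := poly132_add_two (m := n + h) (k := n) (by omega)
    rwa [show n + 1 + (h + 1) = n + h + 2 by ring, show n + (h + 2) = n + h + 2 by ring]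
  · simpa [h0] using shiftedSeries_zero hF
  · intro h
    simpa [h0] using shiftedSeries_succ hz hF h

theorem involutionBGF_eq_mk {τ : Equiv.Perm (Fin 3)}
    {P : ∀ n, Equiv.Perm (Fin n) → Prop} (h : ∀ n (σ : Equiv.Perm (Fin n)),
      AvoidsPattern σ τ ↔ P n σ) :
    involutionBGF τ =
      PowerSeries.mk fun n => fixedPointPoly fun σ => Function.Involutive σ ∧ P n σ := by
  ext1 n
  rw [involutionBGF, coeff_mk, coeff_mk, fixedPointPoly]
  refine Finset.sum_congr ?_ fun _ _ => rfl
  ext σ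
  simp only [avoidingInvolutions, Finset.mem_filter, Finset.mem_univ, true_and, h]
  refine and_congr_left fun _ => ?_
  rw [_root_.inv_eq_iff_mul_eq_one, Equiv.ext_iff]
  rfl

end GeneratingFunctions

theorem mainTheorem7 (τ : Equiv.Perm (Fin 3))
    (hτ : ⇑τ = ![2, 1, 0] ∨ ⇑τ = ![0, 2, 1] ∨ ⇑τ = ![1, 0, 2]) :
    involutionBGF τ =
      2 * Ring.inverse (1 - 2 * PowerSeries.C (Polynomial.X : ℚ[X]) * PowerSeries.X +
        formalSqrt (1 - 4 * PowerSeries.X ^ 2)) := by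
  have hc : PowerSeries.constantCoeff (1 - 4 * PowerSeries.X ^ 2 : PowerSeries ℚ[X]) = 1 := by simp
  have hsq := formalSqrt_sq _ hc
  have hs0 := constantCoeff_formalSqrt _ hc
  have hinv := Ring.mul_inverse_cancel _ isUnit_bgfDenominator
  set s := formalSqrt (1 - 4 * PowerSeries.X ^ 2)
  set D := Ring.inverse (1 - 2 * PowerSeries.C (Polynomial.X : ℚ[X]) * PowerSeries.X + s)
  have h2 : IsUnit (2 : ℚ[X]) := by
    have : IsUnit (Polynomial.C (2 : ℚ)) := Polynomial.isUnit_C.2 (by norm_num)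
    exact this
  obtain ⟨z, hz, hz'⟩ := exists_quadratic_root_of_sq hsq
    (PowerSeries.isUnit_iff_constantCoeff.2 (by
      rw [map_add, hs0, map_one, one_add_one_eq_two]
      exact h2))
  -- Since 2tz = 1 - s, the denominator 1 - 2xt + s equals 2(1 - xt - tz).
  have hF : (2 * D) * (1 - PowerSeries.C (Polynomial.X : ℚ[X]) * PowerSeries.X
      - PowerSeries.X * z) = 1 := by
    linear_combination hinv - D * hz'
  rcases hτ with hτ | hτ | hτ
  · rw [involutionBGF_eq_mk fun n σ => avoidsPattern_321_iff σ hτ]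
    ext1 n
    rw [PowerSeries.coeff_mk, ← poly321_eq_coeff hz hF]
    exact fixedPointPoly_congr fun σ => by simp
  · rw [involutionBGF_eq_mk fun n σ => avoidsPattern_132_iff σ hτ]
    ext1 n
    rw [PowerSeries.coeff_mk, ← poly132_eq_coeff hz hF]
    exact fixedPointPoly_congr fun σ => by simp [Fin.is_le']
  · rw [involutionBGF_eq_mk fun n σ => avoidsPattern_213_iff σ hτ]
    ext1 n
    rw [PowerSeries.coeff_mk, ← poly132_eq_coeff hz hF]
    refine Eq.trans (fixedPointPoly_congr fun σ => ?_) (fixedPointPoly_conj Fin.revPerm _)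
    have : Function.Involutive (Fin.revPerm * σ * Fin.revPerm⁻¹ : Equiv.Perm (Fin n)) ↔ Function.Involutive σ := by
      have hr : ∀ i : Fin n, (Fin.revPerm * σ * Fin.revPerm⁻¹ : Equiv.Perm (Fin n)) i = Fin.rev (σ (Fin.rev i)) :=
        fun i => rfl
      constructor
      · intro h i
        simpa [hr] using h (Fin.rev i)
      · intro h i
        simp [hr, h (Fin.rev i)]
    rw [this]
    exact (and_iff_left fun i _ => Fin.is_le').symm
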